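/- Let $\delta\ge 1$ be an integer and let $\beta,\mu,\nu$ be real numbers with $\mu+\nu=0$. Put $m_n=n-\delta+1$ and let $(T_n(x))_{n\ge\delta-1}$ be the real polynomials with $T_{\delta-1}(x)=1$ and, for $n\ge\delta-1$, $$T_{n+1}(x)=(-m_n\mu x^2+\beta x+\beta+m_n\nu)\,T_n(x)+(\mu x^3+\nu x^2-\nu x-\mu)\,T_n'(x).$$ Then the following hold. (i) If $\nu\neq0$, then the exponential generating function is $$\sum_{n\ge0}T_{n+\delta-1}(x)\frac{t^n}{n!}=\left(\frac{1-x}{(1-x)\cos(\nu(1-x)t)-(1+x)\sin(\nu(1-x)t)}\right)^{\beta/\nu}.$$ Precisely: for every real $x\ne1$ there is $\varepsilon>0$ such that for $|t|<\varepsilon$ the base on the right is positive and the series converges to the right-hand side; for $x=1$ the same holds with the limiting value $(1-2\nu t)^{-\beta/\nu}$, where $1-2\nu t>0$. (ii) The ordinary generating function has, as a formal power series in $t$ over $\mathbb{R}[x]$, the Jacobi continued fraction expansion $$\sum_{n\ge0}T_{n+\delta-1}(x)t^n=\cfrac{1}{1-r_0t-\cfrac{s_1t^2}{1-r_1t-\cfrac{s_2t^2}{1-r_2t-\cdots}}},$$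 where $r_i=(2\nu i+\beta)(1+x)$ and $s_i=2\nu i[\beta+\nu(i-1)](1+x^2)$; that is, the finite truncations converge to the series coefficientwise. (iii) If $\nu\ge0$ and $\beta\ge0$, then the sequence $(T_{n+\delta-1}(q))_{n\ge0}$ is strongly $q$-log-convex: with $f_n=T_{n+\delta-1}$, the polynomial $f_{n+1}(q)f_{m-1}(q)-f_n(q)f_m(q)$ has only nonnegative coefficients for all $n\ge m\ge1$. (iv) If $\nu>0$ and $\beta>0$, then for every $n\ge\delta+2$ the polynomial $T_n(x)$ is not $\gamma$-positive, i.e. it cannot be written as $\sum_{k=0}^{\lfloor d/2\rfloor}g_kx^k(1+x)^{d-2k}$ with an integer $d\ge0$ and all $g_k\ge0$. -/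

import Mathlib

open Polynomial Filter

/-- `T` is the symmetric family with constant real parameters `β, μ, ν` and with `m_n = n - δ + 1`:
it starts at index `δ - 1` (where `m_n = 0`) with the constant polynomial `1`, and for `n ≥ δ - 1`
`T_{n+1} = (-m_n μ x² + β x + β + m_n ν) T_n + (μ x³ + ν x² - ν x - μ) T_n'`.
The values `T_n` with `n < δ - 1` play no role. -/
structure IsSymmetricFamily (β μ ν : ℝ) (δ : ℕ) (T : ℕ → ℝ[X]) : Prop where
  init : T (δ - 1) = 1
  step : ∀ n : ℕ, δ - 1 ≤ n →
    T (n + 1) =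
      (C (-((n : ℝ) - δ + 1) * μ) * X ^ 2 + C β * X + C (β + ((n : ℝ) - δ + 1) * ν)) * T n
        + (C μ * X ^ 3 + C ν * X ^ 2 - C ν * X - C μ) * derivative (T n)

section JFraction

variable {R : Type*} [CommRing R]

/-- The finite continued fraction with `N` levels that starts at level `i`:
`1/(1 - r_i t - s_{i+1} t²/(1 - r_{i+1} t - ... ))`, as a formal power series in `t`
(every denominator has constant coefficient `1`, so it is invertible). -/
noncomputable def jConvergent (r s : ℕ → R) : ℕ → ℕ → PowerSeries R
  | 0, _ => 0
  | N + 1, i => PowerSeries.invOfUnit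
      (1 - PowerSeries.C (r i) * PowerSeries.X
        - PowerSeries.C (s (i + 1)) * PowerSeries.X ^ 2 * jConvergent r s N (i + 1)) 1

/-- The inverse in `jConvergent` is a genuine inverse. -/
theorem jConvergent_succ_mul (r s : ℕ → R) (N i : ℕ) :
    (1 - PowerSeries.C (r i) * PowerSeries.X
        - PowerSeries.C (s (i + 1)) * PowerSeries.X ^ 2 * jConvergent r s N (i + 1))
      * jConvergent r s (N + 1) i = 1 := by
  rw [jConvergent]
  exact PowerSeries.mul_invOfUnit _ _ (by simp)

/-- The formal power series `f` in `t` has the Jacobi continued fraction expansion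
`1/(1 - r_0 t - s_1 t²/(1 - r_1 t - s_2 t²/(1 - r_2 t - ...)))`: the finite
continued fractions converge to `f` coefficientwise, i.e. in the `t`-adic topology. -/
def HasJFraction (f : PowerSeries R) (r s : ℕ → R) : Prop :=
  ∀ n : ℕ, ∀ᶠ N in atTop, PowerSeries.coeff n (jConvergent r s N 0) = PowerSeries.coeff n f

end JFraction

/-- `f_{n+1} f_{m-1} - f_n f_m` has only nonnegative coefficients for all `n ≥ m ≥ 1`. -/
def StronglyQLogConvex (f : ℕ → ℝ[X]) : Prop :=
  ∀ n m : ℕ, 1 ≤ m → m ≤ n → ∀ k : ℕ, 0 ≤ (f (n + 1) * f (m - 1) - f n * f m).coeff k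

/-- `f = ∑_{k ≤ d/2} g_k x^k (1+x)^{d-2k}` for some `d` with all `g_k ≥ 0`. -/
def GammaPositive (f : ℝ[X]) : Prop :=
  ∃ (d : ℕ) (g : ℕ → ℝ), (∀ k, 0 ≤ g k) ∧
    f = ∑ k ∈ Finset.range (d / 2 + 1), C (g k) * X ^ k * (1 + X) ^ (d - 2 * k)

/-! Everything is read off one tridiagonal array `a n k` built from `r` and `s`: row `n` is `(1, 0,
0, ...)` times the `n`-th power of a Jacobi matrix `J`. For the coefficients at hand, neighbouring
columns satisfy `2(k+1)(β+νk) a n (k+1) = (n-k) a n k + (1-x) (a n k)'`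
(`symmetricArray_mul_column_succ`). At `k = 0` this eliminates column 1 and turns the row rule for
column 0 into the recurrence of `T` with `μ = -ν`, so column 0 is the family
(`IsSymmetricFamily.eq_symmetricArray`).

(ii) Ratios of consecutive column generating functions are the tails of the continued fraction
(`hasJFraction_stieltjesArray`). (iii) The second-order minors of `J` are coefficientwise
nonnegative, so by Cauchy-Binet those of the array are too (`stieltjesArray_minor_mem`), and the
log-convexity difference is `s 1` times such a minor.

(i) The columns have exponential generating functions `F G^k / k!`, where `G` solves a Riccati
equation and `F'/F` is affine in `G` (`hasDerivAt_geometric_column`); both are explicit.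

(iv) Gamma-positivity rules out cancellation at `x = i` and forces `f(1)² ≤ 2^deg f · |f(i)|²`
(`GammaPositive.eval_one_sq_le`). Here `f(i) = (β(1+i))^n`, whereas `f(1) = ∏ 2(β+νk)` exceeds
`(2β)^n`, which is too large. -/

/-- The array whose row `n + 1` is row `n` times the tridiagonal matrix with diagonal `r`,
superdiagonal `1` and subdiagonal `s`, and whose row `0` is `a`. -/
def tridiagArray {R : Type*} [CommRing R] (r s a : ℕ → R) : ℕ → ℕ → R
  | 0, k => a k
  | n + 1, 0 => r 0 * tridiagArray r s a n 0 + s 1 * tridiagArray r s a n 1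
  | n + 1, k + 1 => tridiagArray r s a n k + r (k + 1) * tridiagArray r s a n (k + 1)
      + s (k + 2) * tridiagArray r s a n (k + 2)

/-- The array of the Jacobi continued fraction with coefficients `r` and `s`. -/
def stieltjesArray {R : Type*} [CommRing R] (r s : ℕ → R) : ℕ → ℕ → R :=
  tridiagArray r s fun k => if k = 0 then 1 else 0

/-! ### Stieltjes arrays and Jacobi continued fractions -/

section StieltjesArray

variable {R : Type*} [CommRing R] (r s : ℕ → R)

theorem stieltjesArray_zero_zero : stieltjesArray r s 0 0 = 1 := by
  simp [stieltjesArray, tridiagArray]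

theorem stieltjesArray_zero_succ (k : ℕ) : stieltjesArray r s 0 (k + 1) = 0 := by
  simp [stieltjesArray, tridiagArray]

theorem stieltjesArray_succ_zero (n : ℕ) : stieltjesArray r s (n + 1) 0 =
    r 0 * stieltjesArray r s n 0 + s 1 * stieltjesArray r s n 1 := by
  simp [stieltjesArray, tridiagArray]

theorem stieltjesArray_succ_succ (n k : ℕ) : stieltjesArray r s (n + 1) (k + 1) =
    stieltjesArray r s n k + r (k + 1) * stieltjesArray r s n (k + 1)
      + s (k + 2) * stieltjesArray r s n (k + 2) := by
  simp [stieltjesArray, tridiagArray]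

theorem map_tridiagArray {S : Type*} [CommRing S] (φ : R →+* S) (a : ℕ → R) (n k : ℕ) :
    φ (tridiagArray r s a n k) =
      tridiagArray (fun i => φ (r i)) (fun i => φ (s i)) (fun i => φ (a i)) n k := by
  induction n generalizing k with
  | zero => rfl
  | succ n ih => cases k <;> simp [tridiagArray, ih]

/-- The ordinary generating function of a column of the array. -/
noncomputable def stieltjesColumn (k : ℕ) : PowerSeries R :=
  PowerSeries.mk fun n => stieltjesArray r s n k

theorem stieltjesColumn_zero : stieltjesColumn r s 0 = 1 + PowerSeries.X *
    (PowerSeries.C (r 0) * stieltjesColumn r s 0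
      + PowerSeries.C (s 1) * stieltjesColumn r s 1) := by
  ext n
  cases n with
  | zero => simp [stieltjesColumn, stieltjesArray_zero_zero]
  | succ n =>
    simp [stieltjesColumn, stieltjesArray_succ_zero, PowerSeries.coeff_succ_X_mul,
      PowerSeries.coeff_one]

theorem stieltjesColumn_succ (k : ℕ) : stieltjesColumn r s (k + 1) = PowerSeries.X *
    (stieltjesColumn r s k + PowerSeries.C (r (k + 1)) * stieltjesColumn r s (k + 1)
      + PowerSeries.C (s (k + 2)) * stieltjesColumn r s (k + 2)) := by
  ext n
  cases n with
  | zero => simp [stieltjesColumn, stieltjesArray_zero_succ]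
  | succ n =>
    simp [stieltjesColumn, stieltjesArray_succ_succ, PowerSeries.coeff_succ_X_mul]

/-- Substituting the approximation of column `k + 2` by column `k + 1` into the column equation and
solving for column `k + 1` adds one level to the fraction; the factor `X` in that equation gains one
order of accuracy. -/
theorem X_pow_dvd_stieltjesColumn_succ_sub (N k : ℕ) : (PowerSeries.X : PowerSeries R) ^ N ∣
    stieltjesColumn r s (k + 1)
      - PowerSeries.X * jConvergent r s N (k + 1) * stieltjesColumn r s k := by
  induction N generalizing k with
  | zero => simp
  | succ N ih =>
    obtain ⟨q, hq⟩ := ih (k + 1)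
    refine ⟨PowerSeries.C (s (k + 2)) * q * jConvergent r s (N + 1) (k + 1), ?_⟩
    have hJ := jConvergent_succ_mul r s N (k + 1)
    have hC := stieltjesColumn_succ r s k
    simp only [show k + 1 + 1 = k + 2 from rfl] at hq hJ
    linear_combination (-stieltjesColumn r s (k + 1)) * hJ
      + jConvergent r s (N + 1) (k + 1) * hC
      + jConvergent r s (N + 1) (k + 1) * PowerSeries.X * PowerSeries.C (s (k + 2)) * hq

theorem hasJFraction_stieltjesArray :
    HasJFraction (PowerSeries.mk fun n => stieltjesArray r s n 0) r s := by
  intro n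
  filter_upwards [eventually_gt_atTop n] with N hN
  obtain ⟨N, rfl⟩ : ∃ M, N = M + 1 := ⟨N - 1, by omega⟩
  obtain ⟨q, hq⟩ := X_pow_dvd_stieltjesColumn_succ_sub r s N 0
  have hJ := jConvergent_succ_mul r s N 0
  have hC := stieltjesColumn_zero r s
  simp only [zero_add] at hq hJ
  have key : stieltjesColumn r s 0 - jConvergent r s (N + 1) 0 =
      PowerSeries.X ^ (N + 1) * (PowerSeries.C (s 1) * q * jConvergent r s (N + 1) 0) := by
    linear_combination (-stieltjesColumn r s 0) * hJ
      + jConvergent r s (N + 1) 0 * hC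
      + jConvergent r s (N + 1) 0 * PowerSeries.X * PowerSeries.C (s 1) * hq
  have h0 := congrArg (PowerSeries.coeff n) key
  rw [PowerSeries.coeff_X_pow_mul', if_neg (by omega), map_sub, sub_eq_zero] at h0
  exact h0.symm

/-! ### Positivity of entries and second-order minors -/

variable {r s}

theorem stieltjesArray_mem (P : Subsemiring R) (hr : ∀ i, r i ∈ P) (hs : ∀ i, s i ∈ P)
    (n k : ℕ) : stieltjesArray r s n k ∈ P := by
  induction n generalizing k with
  | zero =>
    cases k with
    | zero => rw [stieltjesArray_zero_zero]; exact P.one_mem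
    | succ k => rw [stieltjesArray_zero_succ]; exact P.zero_mem
  | succ n ih =>
    cases k with
    | zero =>
      rw [stieltjesArray_succ_zero]
      exact P.add_mem (P.mul_mem (hr _) (ih _)) (P.mul_mem (hs _) (ih _))
    | succ k =>
      rw [stieltjesArray_succ_succ]
      exact P.add_mem (P.add_mem (ih _) (P.mul_mem (hr _) (ih _))) (P.mul_mem (hs _) (ih _))

/-- If `r i`, `s i` and `r i * r (i + 1) - s (i + 1)` are nonnegative, so are the minors of
order two of the array. -/
theorem stieltjesArray_minor_mem (P : Subsemiring R) (hr : ∀ i, r i ∈ P) (hs : ∀ i, s i ∈ P)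
    (hrs : ∀ i, r i * r (i + 1) - s (i + 1) ∈ P) {m n : ℕ} (hmn : m ≤ n) {k l : ℕ}
    (hkl : k ≤ l) :
    stieltjesArray r s m k * stieltjesArray r s n l
      - stieltjesArray r s m l * stieltjesArray r s n k ∈ P := by
  induction m generalizing n k l with
  | zero =>
    rcases hkl.eq_or_lt with rfl | hlt
    · rw [sub_eq_zero.2 rfl]; exact P.zero_mem
    obtain ⟨l, rfl⟩ : ∃ j, l = j + 1 := ⟨l - 1, by omega⟩
    rw [stieltjesArray_zero_succ, zero_mul, sub_zero]
    exact P.mul_mem (stieltjesArray_mem P hr hs _ _) (stieltjesArray_mem P hr hs _ _)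
  | succ m ih =>
    rcases hkl.eq_or_lt with rfl | hlt
    · rw [sub_eq_zero.2 rfl]; exact P.zero_mem
    obtain ⟨n, rfl⟩ : ∃ j, n = j + 1 := ⟨n - 1, by omega⟩
    have hmn' : m ≤ n := by omega
    obtain ⟨j, rfl⟩ := Nat.exists_eq_add_of_lt hlt
    set M : ℕ → ℕ → R := fun i j => stieltjesArray r s m i * stieltjesArray r s n j
      - stieltjesArray r s m j * stieltjesArray r s n i with hM
    have hMP : ∀ i j, i ≤ j → M i j ∈ P := fun i j hij => ih hmn' hij
    have hmul : ∀ {a b : R}, a ∈ P → b ∈ P → a * b ∈ P := P.mul_mem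
    have hadd : ∀ {a b : R}, a ∈ P → b ∈ P → a + b ∈ P := P.add_mem
    cases k with
    | zero =>
      cases j with
      | zero =>
        -- Cauchy-Binet written out. Only for adjacent columns do terms combine with opposite signs,
        -- giving `r i * r (i + 1) - s (i + 1)`; for columns further apart one expands one column
        -- after the other.
        have e : stieltjesArray r s (m + 1) 0 * stieltjesArray r s (n + 1) (0 + 0 + 1)
            - stieltjesArray r s (m + 1) (0 + 0 + 1) * stieltjesArray r s (n + 1) 0
            = (r 0 * r (0 + 1) - s (0 + 1)) * M 0 1 + r 0 * s 2 * M 0 2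
              + s 1 * s 2 * M 1 2 := by
          simp only [hM, stieltjesArray_succ_zero, stieltjesArray_succ_succ, zero_add]
          ring
        rw [e]
        have h01 := hMP 0 1 (by omega)
        have h02 := hMP 0 2 (by omega)
        have h12 := hMP 1 2 (by omega)
        exact hadd (hadd (hmul (hrs 0) h01) (hmul (hmul (hr _) (hs _)) h02))
          (hmul (hmul (hs _) (hs _)) h12)
      | succ j =>
        have e : stieltjesArray r s (m + 1) 0 * stieltjesArray r s (n + 1) (0 + (j + 1) + 1)
            - stieltjesArray r s (m + 1) (0 + (j + 1) + 1) * stieltjesArray r s (n + 1) 0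
            = r 0 * (M 0 (j + 1) + r (j + 2) * M 0 (j + 2) + s (j + 3) * M 0 (j + 3))
              + s 1 * (M 1 (j + 1) + r (j + 2) * M 1 (j + 2) + s (j + 3) * M 1 (j + 3)) := by
          simp only [hM, stieltjesArray_succ_zero, stieltjesArray_succ_succ, zero_add,
            add_assoc, Nat.reduceAdd]
          ring
        rw [e]
        have aux : ∀ i, i ≤ j + 1 →
            M i (j + 1) + r (j + 2) * M i (j + 2) + s (j + 3) * M i (j + 3) ∈ P := fun i hi =>
          hadd (hadd (hMP _ _ hi) (hmul (hr _) (hMP _ _ (by omega))))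
            (hmul (hs _) (hMP _ _ (by omega)))
        exact hadd (hmul (hr _) (aux _ (by omega))) (hmul (hs _) (aux _ (by omega)))
    | succ k =>
      cases j with
      | zero =>
        have e : stieltjesArray r s (m + 1) (k + 1)
              * stieltjesArray r s (n + 1) (k + 1 + 0 + 1)
            - stieltjesArray r s (m + 1) (k + 1 + 0 + 1) * stieltjesArray r s (n + 1) (k + 1)
            = M k (k + 1) + r (k + 2) * M k (k + 2) + s (k + 3) * M k (k + 3)
              + ((r (k + 1) * r (k + 1 + 1) - s (k + 1 + 1)) * M (k + 1) (k + 2)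
                + r (k + 1) * s (k + 3) * M (k + 1) (k + 3))
              + s (k + 2) * s (k + 3) * M (k + 2) (k + 3) := by
          simp only [hM, stieltjesArray_succ_succ, add_zero, add_assoc, Nat.reduceAdd]
          ring
        rw [e]
        exact hadd (hadd (hadd (hadd (hMP _ _ (by omega)) (hmul (hr _) (hMP _ _ (by omega))))
            (hmul (hs _) (hMP _ _ (by omega))))
          (hadd (hmul (hrs _) (hMP _ _ (by omega)))
            (hmul (hmul (hr _) (hs _)) (hMP _ _ (by omega)))))
          (hmul (hmul (hs _) (hs _)) (hMP _ _ (by omega)))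
      | succ j =>
        have e : stieltjesArray r s (m + 1) (k + 1)
              * stieltjesArray r s (n + 1) (k + 1 + (j + 1) + 1)
            - stieltjesArray r s (m + 1) (k + 1 + (j + 1) + 1)
              * stieltjesArray r s (n + 1) (k + 1)
            = (M k (k + j + 2) + r (k + j + 3) * M k (k + j + 3)
                + s (k + j + 4) * M k (k + j + 4))
              + r (k + 1) * (M (k + 1) (k + j + 2) + r (k + j + 3) * M (k + 1) (k + j + 3)
                + s (k + j + 4) * M (k + 1) (k + j + 4))
              + s (k + 2) * (M (k + 2) (k + j + 2) + r (k + j + 3) * M (k + 2) (k + j + 3)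
                + s (k + j + 4) * M (k + 2) (k + j + 4)) := by
          rw [show k + 1 + (j + 1) + 1 = k + j + 2 + 1 by omega]
          simp only [hM, stieltjesArray_succ_succ]
          ring
        rw [e]
        have aux : ∀ i, i ≤ k + j + 2 →
            M i (k + j + 2) + r (k + j + 3) * M i (k + j + 3)
              + s (k + j + 4) * M i (k + j + 4) ∈ P := fun i hi =>
          hadd (hadd (hMP _ _ hi) (hmul (hr _) (hMP _ _ (by omega))))
            (hmul (hs _) (hMP _ _ (by omega)))
        exact hadd (hadd (aux _ (by omega)) (hmul (hr _) (aux _ (by omega))))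
          (hmul (hs _) (aux _ (by omega)))

end StieltjesArray

/-! ### Tridiagonal linear differential systems -/

/-- The entries of a tridiagonal array whose initial row is a solution of the associated linear
system are the iterated derivatives of that solution. -/
theorem iteratedDeriv_eventuallyEq_tridiagArray {r s : ℕ → ℝ} {φ : ℕ → ℝ → ℝ} {x : ℝ}
    (h : ∀ᶠ t in nhds x, ∀ k, HasDerivAt (φ k) (tridiagArray r s (fun i => φ i t) 1 k) t)
    (n k : ℕ) : iteratedDeriv n (φ k) =ᶠ[nhds x]
      fun t => tridiagArray r s (fun i => φ i t) n k := by
  -- The hypothesis says `φ' = φ J` with `J` constant in `t`, so `(φ J^n)' = φ J^(n+1)`.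
  have key : ∀ᶠ t in nhds x, ∀ n k,
      HasDerivAt (fun u => tridiagArray r s (fun i => φ i u) n k)
        (tridiagArray r s (fun i => φ i t) (n + 1) k) t := by
    filter_upwards [h] with t ht n
    induction n with
    | zero => exact ht
    | succ n ih =>
      intro k
      cases k with
      | zero =>
        exact ((ih 0).const_mul (r 0)).add ((ih 1).const_mul (s 1))
      | succ k =>
        exact ((ih k).add ((ih (k + 1)).const_mul (r (k + 1)))).add
          ((ih (k + 2)).const_mul (s (k + 2)))
  induction n with
  | zero => simp [tridiagArray]
  | succ n ih =>
    rw [iteratedDeriv_succ]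
    refine ih.deriv.trans ?_
    filter_upwards [key] with t ht
    exact (ht n k).deriv

/-! ### The array of the symmetric family -/

/-- The diagonal coefficients of the Jacobi continued fraction of a symmetric family. -/
noncomputable def symmetricDiag (β ν : ℝ) (i : ℕ) : ℝ[X] := C (2 * ν * i + β) * (1 + X)

/-- The off-diagonal coefficients of the Jacobi continued fraction of a symmetric family. -/
noncomputable def symmetricOffDiag (β ν : ℝ) (i : ℕ) : ℝ[X] :=
  C (2 * ν * i * (β + ν * ((i : ℝ) - 1))) * (1 + X ^ 2)

/-- The Stieltjes array attached to a symmetric family. -/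
noncomputable def symmetricArray (β ν : ℝ) : ℕ → ℕ → ℝ[X] :=
  stieltjesArray (symmetricDiag β ν) (symmetricOffDiag β ν)

/-- Consecutive columns of the array are related by a first-order differential operator. -/
theorem symmetricArray_mul_column_succ (β ν : ℝ) (n k : ℕ) :
    C (2 * ((k : ℝ) + 1) * (β + ν * k)) * symmetricArray β ν n (k + 1) =
      C ((n : ℝ) - k) * symmetricArray β ν n k
        + (1 - X) * derivative (symmetricArray β ν n k) := by
  induction n generalizing k with
  | zero =>
    cases k with
    | zero => simp [symmetricArray, stieltjesArray_zero_zero, stieltjesArray_zero_succ]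
    | succ k => simp [symmetricArray, stieltjesArray_zero_succ]
  | succ n ih =>
    cases k with
    | zero =>
      have h0 := ih 0
      have h1 := ih 1
      simp only [symmetricArray, stieltjesArray_succ_succ, stieltjesArray_succ_zero,
        zero_add] at h0 h1 ⊢
      generalize stieltjesArray (symmetricDiag β ν) (symmetricOffDiag β ν) n 0 = a0 at *
      generalize stieltjesArray (symmetricDiag β ν) (symmetricOffDiag β ν) n 1 = a1 at *
      simp only [Nat.reduceAdd] at h1
      generalize stieltjesArray (symmetricDiag β ν) (symmetricOffDiag β ν) n 2 = a2 at *
      simp only [symmetricDiag, symmetricOffDiag, derivative_mul, derivative_C,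
        derivative_X, derivative_one, derivative_X_pow, derivative_ofNat,
        map_add, map_sub, map_mul, map_one,
        map_natCast, map_ofNat, Nat.cast_add, Nat.cast_one, Nat.cast_zero, map_zero,
        Nat.cast_ofNat] at h0 h1 ⊢
      linear_combination (C β * (1 + X)) * h0 + (2 * C ν * C β * (1 + X ^ 2)) * h1
    | succ k =>
      have h0 := ih k
      have h1 := ih (k + 1)
      have h2 := ih (k + 2)
      simp only [symmetricArray, stieltjesArray_succ_succ, add_assoc, Nat.reduceAdd]
        at h0 h1 h2 ⊢
      generalize stieltjesArray (symmetricDiag β ν) (symmetricOffDiag β ν) n k = a0 at *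
      generalize stieltjesArray (symmetricDiag β ν) (symmetricOffDiag β ν) n (k + 1) = a1 at *
      generalize stieltjesArray (symmetricDiag β ν) (symmetricOffDiag β ν) n (k + 2) = a2 at *
      generalize stieltjesArray (symmetricDiag β ν) (symmetricOffDiag β ν) n (k + 3) = a3 at *
      simp only [symmetricDiag, symmetricOffDiag, derivative_mul, derivative_C,
        derivative_X, derivative_one, derivative_X_pow, derivative_natCast, derivative_ofNat,
        map_add, map_sub, map_mul, map_one,
        map_natCast, map_ofNat, Nat.cast_add, Nat.cast_one, 
        Nat.cast_ofNat] at h0 h1 h2 ⊢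
      -- The multipliers are the row coefficients `1`, `r (k+1)`, `s (k+2)`; terms from
      -- differentiating them cancel against the shifts in the scalar factors.
      linear_combination h0 + ((2 * C ν * ((k : ℝ[X]) + 1) + C β) * (1 + X)) * h1
        + (2 * C ν * ((k : ℝ[X]) + 2) * (C β + C ν * ((k : ℝ[X]) + 1)) * (1 + X ^ 2)) * h2

/-- The zeroth column of the array satisfies the recurrence of the symmetric family. -/
theorem symmetricArray_column_zero_succ (β ν : ℝ) (n : ℕ) :
    symmetricArray β ν (n + 1) 0 =
      (C (n * ν) * (1 + X ^ 2) + C β * (1 + X)) * symmetricArray β ν n 0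
        + C ν * ((1 - X) * (1 + X ^ 2)) * derivative (symmetricArray β ν n 0) := by
  have h := symmetricArray_mul_column_succ β ν n 0
  simp only [symmetricArray, stieltjesArray_succ_zero] at h ⊢
  simp only [symmetricDiag, symmetricOffDiag, map_add, map_sub, map_mul, map_one,
    map_natCast, map_ofNat, Nat.cast_one, Nat.cast_zero, map_zero, zero_add] at h ⊢
  -- `s 1` is `ν(1+X²)` times the factor `2β` of column 1 in `h`, so there is no division by `β`.
  linear_combination C ν * (1 + X ^ 2) * h

theorem IsSymmetricFamily.eq_symmetricArray {β μ ν : ℝ} {δ : ℕ} (hδ : 1 ≤ δ) (hμν : μ + ν = 0)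
    {T : ℕ → ℝ[X]} (hT : IsSymmetricFamily β μ ν δ T) (n : ℕ) :
    T (n + δ - 1) = symmetricArray β ν n 0 := by
  induction n with
  | zero => simp [hT.init, symmetricArray, stieltjesArray_zero_zero]
  | succ n ih =>
    obtain rfl : μ = -ν := by linarith
    have h := hT.step (n + δ - 1) (by omega)
    rw [show n + δ - 1 + 1 = n + 1 + δ - 1 by omega, ih] at h
    have hc : ((n + δ - 1 : ℕ) : ℝ) - δ + 1 = n := by
      rw [Nat.cast_sub (by omega)]; push_cast; ring
    rw [symmetricArray_column_zero_succ, h]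
    rw [hc]
    simp only [map_add, map_mul, map_neg]
    ring

/-- Each step to the right costs one degree, matching `deg r ≤ 1` and `deg s ≤ 2`. Using `degree`
lets the zero entries beyond the diagonal satisfy the bound. -/
theorem degree_symmetricArray_add_le (β ν : ℝ) (n k : ℕ) :
    (symmetricArray β ν n k).degree + k ≤ n := by
  have hr : ∀ i, (symmetricDiag β ν i).degree ≤ 1 := fun i => by
    unfold symmetricDiag; compute_degree
  have hs : ∀ i, (symmetricOffDiag β ν i).degree ≤ 2 := fun i => by
    unfold symmetricOffDiag; compute_degree
  have h1 : ∀ n k, (symmetricArray β ν n k).degree + k ≤ n →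
      (symmetricDiag β ν k * symmetricArray β ν n k).degree + k ≤ (n + 1 : ℕ) := by
    intro n k h
    rw [degree_mul]
    calc _ ≤ 1 + ((symmetricArray β ν n k).degree + k) := by
          rw [add_assoc]; gcongr; exact hr k
      _ ≤ 1 + n := by gcongr
      _ = _ := by push_cast; exact add_comm _ _
  have h2 : ∀ n k, (symmetricArray β ν n (k + 1)).degree + (k + 1 : ℕ) ≤ n →
      (symmetricOffDiag β ν (k + 1) * symmetricArray β ν n (k + 1)).degree + k
        ≤ (n + 1 : ℕ) := by
    intro n k h
    rw [degree_mul]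
    calc _ ≤ 2 + (symmetricArray β ν n (k + 1)).degree + k := by
          gcongr; exact hs (k + 1)
      _ = 1 + ((symmetricArray β ν n (k + 1)).degree + (k + 1 : ℕ)) := by
          rw [← one_add_one_eq_two]; push_cast; abel
      _ ≤ 1 + n := by gcongr
      _ = _ := by push_cast; exact add_comm _ _
  have hadd : ∀ {p q : ℝ[X]} {k N : ℕ}, p.degree + k ≤ N → q.degree + k ≤ N →
      (p + q).degree + k ≤ N := by
    intro p q k N hp hq
    refine (add_le_add_left (degree_add_le p q) _).trans ?_
    rcases max_choice p.degree q.degree with h | h <;> rwa [h]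
  induction n generalizing k with
  | zero =>
    cases k with
    | zero => simp [symmetricArray, stieltjesArray_zero_zero]
    | succ k => simp [symmetricArray, stieltjesArray_zero_succ]
  | succ n ih =>
    cases k with
    | zero =>
      have := hadd (h1 n 0 (ih 0)) (h2 n 0 (ih 1))
      rwa [symmetricArray, stieltjesArray_succ_zero]
    | succ k =>
      have h0 : (symmetricArray β ν n k).degree + (k + 1 : ℕ) ≤ (n + 1 : ℕ) := by
        push_cast
        rw [← add_assoc]
        gcongr
        exact ih k
      have := hadd (hadd h0 (h1 n (k + 1) (ih (k + 1)))) (h2 n (k + 1) (ih (k + 2)))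
      rwa [symmetricArray, stieltjesArray_succ_succ]

theorem natDegree_symmetricArray_zero_le (β ν : ℝ) (n : ℕ) :
    (symmetricArray β ν n 0).natDegree ≤ n :=
  natDegree_le_iff_degree_le.2 (by simpa using degree_symmetricArray_add_le β ν n 0)

/-! ### Nonnegative coefficients and log-convexity -/

/-- The real polynomials with nonnegative coefficients. -/
def nonnegCoeffs : Subsemiring ℝ[X] where
  carrier := {p | ∀ k, 0 ≤ p.coeff k}
  zero_mem' := by simp
  one_mem' := fun k => by rw [coeff_one]; split_ifs <;> simp
  add_mem' := fun hp hq k => by rw [coeff_add]; exact add_nonneg (hp k) (hq k)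
  mul_mem' := fun hp hq k => by
    rw [coeff_mul]; exact Finset.sum_nonneg fun x _ => mul_nonneg (hp _) (hq _)

theorem C_mem_nonnegCoeffs {a : ℝ} (ha : 0 ≤ a) : C a ∈ nonnegCoeffs := fun k => by
  rw [coeff_C]; split_ifs <;> simp [ha]

theorem X_mem_nonnegCoeffs : X ∈ nonnegCoeffs := fun k => by
  rw [coeff_X]; split_ifs <;> simp

theorem symmetricDiag_mem {β ν : ℝ} (hν : 0 ≤ ν) (hβ : 0 ≤ β) (i : ℕ) :
    symmetricDiag β ν i ∈ nonnegCoeffs :=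
  mul_mem (C_mem_nonnegCoeffs (by positivity)) (add_mem (one_mem _) X_mem_nonnegCoeffs)

theorem symmetricOffDiag_mem {β ν : ℝ} (hν : 0 ≤ ν) (hβ : 0 ≤ β) (i : ℕ) :
    symmetricOffDiag β ν i ∈ nonnegCoeffs := by
  refine mul_mem (C_mem_nonnegCoeffs ?_) (add_mem (one_mem _) (pow_mem X_mem_nonnegCoeffs 2))
  rcases i.eq_zero_or_pos with rfl | hi
  · simp
  · have : (0 : ℝ) ≤ (i : ℝ) - 1 := sub_nonneg.2 (by exact_mod_cast hi)
    positivity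

/-- Since `(1+x)² = (1+x²) + 2x`, the subtraction affects only the coefficient of `1+x²`, where all
negative terms cancel. -/
theorem symmetricDiag_mul_sub_mem {β ν : ℝ} (hν : 0 ≤ ν) (hβ : 0 ≤ β) (i : ℕ) :
    symmetricDiag β ν i * symmetricDiag β ν (i + 1) - symmetricOffDiag β ν (i + 1)
      ∈ nonnegCoeffs := by
  have e : symmetricDiag β ν i * symmetricDiag β ν (i + 1) - symmetricOffDiag β ν (i + 1) =
      C (2 * ν ^ 2 * i ^ 2 + 2 * ν * i * β + β ^ 2 + 2 * ν ^ 2 * i) * (1 + X ^ 2)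
        + C (2 * ((2 * ν * i + β) * (2 * ν * (i + 1) + β))) * X := by
    simp only [symmetricDiag, symmetricOffDiag, map_add, map_sub, map_mul, map_one, map_pow,
      map_natCast, map_ofNat, Nat.cast_add, Nat.cast_one]
    ring
  rw [e]
  exact add_mem (mul_mem (C_mem_nonnegCoeffs (by positivity))
      (add_mem (one_mem _) (pow_mem X_mem_nonnegCoeffs 2)))
    (mul_mem (C_mem_nonnegCoeffs (by positivity)) X_mem_nonnegCoeffs)

theorem stronglyQLogConvex_symmetricArray {β ν : ℝ} (hν : 0 ≤ ν) (hβ : 0 ≤ β) :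
    StronglyQLogConvex fun n => symmetricArray β ν n 0 := by
  intro n m hm hmn
  obtain ⟨m, rfl⟩ : ∃ j, m = j + 1 := ⟨m - 1, by omega⟩
  have hr := symmetricDiag_mem hν hβ
  have hs := symmetricOffDiag_mem hν hβ
  have e : symmetricArray β ν (n + 1) 0 * symmetricArray β ν (m + 1 - 1) 0
      - symmetricArray β ν n 0 * symmetricArray β ν (m + 1) 0 =
      symmetricOffDiag β ν 1 * (symmetricArray β ν m 0 * symmetricArray β ν n 1
        - symmetricArray β ν m 1 * symmetricArray β ν n 0) := by
    simp only [symmetricArray, stieltjesArray_succ_zero, Nat.add_sub_cancel]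
    ring
  change _ ∈ nonnegCoeffs
  simp only [e]
  exact mul_mem (hs 1) (stieltjesArray_minor_mem nonnegCoeffs hr hs
    (symmetricDiag_mul_sub_mem hν hβ) (by omega) (by omega))

/-- Dropping the nonnegative `s 1` term leaves a factor `β` per row. This makes the constant term
positive when `β > 0`. -/
theorem pow_le_coeff_zero_symmetricArray {β ν : ℝ} (hν : 0 ≤ ν) (hβ : 0 ≤ β) (n : ℕ) :
    β ^ n ≤ (symmetricArray β ν n 0).coeff 0 := by
  induction n with
  | zero => simp [symmetricArray, stieltjesArray_zero_zero]
  | succ n ih =>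
    have h1 : 0 ≤ (symmetricOffDiag β ν 1 * symmetricArray β ν n 1).coeff 0 :=
      mul_mem (symmetricOffDiag_mem hν hβ 1) (stieltjesArray_mem nonnegCoeffs
        (symmetricDiag_mem hν hβ) (symmetricOffDiag_mem hν hβ) n 1) 0
    have h0 : (symmetricDiag β ν 0).coeff 0 = β := by simp [symmetricDiag]
    have e : symmetricArray β ν (n + 1) 0 = symmetricDiag β ν 0 * symmetricArray β ν n 0
        + symmetricOffDiag β ν 1 * symmetricArray β ν n 1 := stieltjesArray_succ_zero _ _ n
    rw [e, coeff_add, mul_coeff_zero, h0, pow_succ']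
    nlinarith

/-! ### Special values and failure of gamma-positivity -/

theorem eval_one_symmetricArray (β ν : ℝ) (n : ℕ) : (symmetricArray β ν n 0).eval 1 =
    ∏ k ∈ Finset.range n, (2 * (β + ν * k)) := by
  induction n with
  | zero => simp [symmetricArray, stieltjesArray_zero_zero]
  | succ n ih =>
    rw [Finset.prod_range_succ, symmetricArray_column_zero_succ, ← ih]
    simp
    ring

/-- At `i` the factor `1+X²` vanishes, leaving only multiplication by `β(1+X)`. -/
theorem aeval_I_symmetricArray (β ν : ℝ) (n : ℕ) :
    aeval Complex.I (symmetricArray β ν n 0) = (β * (1 + Complex.I)) ^ n := by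
  induction n with
  | zero => simp [symmetricArray, stieltjesArray_zero_zero]
  | succ n ih =>
    rw [symmetricArray_column_zero_succ, pow_succ _ n, ← ih]
    simp [mul_comm]

theorem two_mul_pow_lt_eval_one_symmetricArray {β ν : ℝ} (hν : 0 < ν) (hβ : 0 < β) {n : ℕ}
    (hn : 2 ≤ n) : (2 * β) ^ n < (symmetricArray β ν n 0).eval 1 := by
  rw [eval_one_symmetricArray]
  calc (2 * β) ^ n = ∏ _k ∈ Finset.range n, (2 * β) := by simp
    _ < _ := by
      refine Finset.prod_lt_prod (fun _ _ => by positivity) (fun k _ => ?_)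
        -- The factor `k = 0` equals `2β`; strictness starts at `k = 1`.
        ⟨1, Finset.mem_range.2 hn, ?_⟩
      · have : 0 ≤ ν * k := by positivity
        linarith
      · simp; linarith

/-- A gamma-positive polynomial that does not vanish at the origin is bounded at `1` in terms of
its value at the imaginary unit. -/
theorem GammaPositive.eval_one_sq_le {f : ℝ[X]} (hf : GammaPositive f) (h0 : 0 < f.coeff 0) :
    f.eval 1 ^ 2 ≤ 2 ^ f.natDegree * Complex.normSq (aeval Complex.I f) := by
  obtain ⟨d, g, hg, rfl⟩ := hf
  set f : ℝ[X] := ∑ k ∈ Finset.range (d / 2 + 1), C (g k) * X ^ k * (1 + X) ^ (d - 2 * k)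
    with hfdef
  have hc0 : f.coeff 0 = g 0 := by
    rw [hfdef, finsetSum_coeff, Finset.sum_range_succ']
    simp [coeff_zero_eq_eval_zero]
  -- The summand `g_0 (1+x)^d` reaches `x^d` and nothing cancels it, which ties the arbitrary `d` to
  -- the degree of `f`.
  have hcd : g 0 ≤ f.coeff d := by
    have hmem : ∀ k, C (g k) * X ^ k * (1 + X) ^ (d - 2 * k) ∈ nonnegCoeffs := fun k =>
      mul_mem (mul_mem (C_mem_nonnegCoeffs (hg k)) (pow_mem X_mem_nonnegCoeffs k))
        (pow_mem (add_mem (one_mem _) X_mem_nonnegCoeffs) _)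
    rw [hfdef, finsetSum_coeff, Finset.sum_range_succ']
    refine le_add_of_nonneg_of_le (Finset.sum_nonneg fun k _ => hmem _ d) ?_
    simp [coeff_one_add_X_pow]
  have hd : d ≤ f.natDegree := le_natDegree_of_ne_zero (by linarith)
  set H : ℝ := ∑ k ∈ Finset.range (d / 2 + 1), g k * (1 / 2) ^ k with hH
  have hH0 : 0 ≤ H := Finset.sum_nonneg fun k _ => mul_nonneg (hg k) (by positivity)
  have h1 : f.eval 1 ≤ 2 ^ d * H := by
    rw [hfdef, eval_finsetSum, hH, Finset.mul_sum]
    refine Finset.sum_le_sum fun k _ => ?_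
    have hk : 2 * k ≤ d := by
      have := Finset.mem_range.1 ‹_›
      omega
    have e : (2 : ℝ) ^ d = 2 ^ (d - 2 * k) * 2 ^ k * 2 ^ k := by
      rw [← pow_add, ← pow_add]; congr 1; omega
    have e2 : (2 : ℝ) ^ d * (g k * (1 / 2) ^ k) = g k * 2 ^ (d - 2 * k) * 2 ^ k := by
      rw [e, one_div, inv_pow]; field_simp
    rw [e2]
    have h2 : (1 : ℝ) ≤ 2 ^ k := one_le_pow₀ (by norm_num)
    have h3 : 0 ≤ g k * (2 : ℝ) ^ (d - 2 * k) := mul_nonneg (hg k) (by positivity)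
    simp only [eval_mul, eval_C, eval_pow, eval_X, eval_add, eval_one, one_pow, mul_one,
      one_add_one_eq_two]
    nlinarith
  have h1' : 0 ≤ f.eval 1 := by
    rw [hfdef, eval_finsetSum]
    refine Finset.sum_nonneg fun k _ => ?_
    have := hg k
    simp only [eval_mul, eval_C, eval_pow, eval_X, eval_add, eval_one]
    positivity
  -- As `(1+i)² = 2i`, each `x^k (1+x)^(d-2k)` takes the value `(1+i)^d / 2^k`: all summands point
  -- the same way.
  have hI : aeval Complex.I f = (1 + Complex.I) ^ d * (H : ℂ) := by
    rw [hfdef, map_sum, hH, Complex.ofReal_sum, Finset.mul_sum]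
    refine Finset.sum_congr rfl fun k hk => ?_
    have hk : 2 * k ≤ d := by
      have := Finset.mem_range.1 hk
      omega
    have hsq : (1 + Complex.I) ^ 2 = 2 * Complex.I := by
      linear_combination Complex.I_sq
    have e : (1 + Complex.I) ^ d = (1 + Complex.I) ^ (d - 2 * k) * (2 * Complex.I) ^ k := by
      rw [← hsq, ← pow_mul, ← pow_add]; congr 1; omega
    simp only [map_mul, aeval_C, map_pow, aeval_X, map_add, map_one, e, Complex.ofReal_mul,
      Complex.ofReal_pow, Complex.ofReal_ofNat, mul_pow,
      one_div, Complex.ofReal_inv, inv_pow, Complex.coe_algebraMap]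
    field_simp
  have hN : Complex.normSq (aeval Complex.I f) = 2 ^ d * H ^ 2 := by
    rw [hI, map_mul, map_pow, Complex.normSq_ofReal, ← sq]
    congr 2
    norm_num [Complex.normSq_apply]
  rw [hN]
  calc f.eval 1 ^ 2 ≤ (2 ^ d * H) ^ 2 := by gcongr
    _ = 2 ^ d * (2 ^ d * H ^ 2) := by ring
    _ ≤ _ := by gcongr; norm_num

theorem not_gammaPositive_symmetricArray {β ν : ℝ} (hν : 0 < ν) (hβ : 0 < β) {n : ℕ}
    (hn : 2 ≤ n) : ¬ GammaPositive (symmetricArray β ν n 0) := by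
  intro h
  have h0 : 0 < (symmetricArray β ν n 0).coeff 0 :=
    (pow_pos hβ n).trans_le (pow_le_coeff_zero_symmetricArray hν.le hβ.le n)
  have h1 := h.eval_one_sq_le h0
  have hN : Complex.normSq (aeval Complex.I (symmetricArray β ν n 0)) = 2 ^ n * (β ^ n) ^ 2 := by
    rw [aeval_I_symmetricArray, map_pow, map_mul, Complex.normSq_ofReal,
      show Complex.normSq (1 + Complex.I) = 2 by norm_num [Complex.normSq_apply]]
    ring
  have h2 : (2 : ℝ) ^ (symmetricArray β ν n 0).natDegree ≤ 2 ^ n :=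
    pow_le_pow_right₀ (by norm_num) (natDegree_symmetricArray_zero_le β ν n)
  have h3 := two_mul_pow_lt_eval_one_symmetricArray hν hβ hn
  have h4 : ((2 * β) ^ n) ^ 2 < (symmetricArray β ν n 0).eval 1 ^ 2 := by gcongr
  rw [hN] at h1
  have h5 : (2 : ℝ) ^ (symmetricArray β ν n 0).natDegree * (2 ^ n * (β ^ n) ^ 2) ≤
      2 ^ n * (2 ^ n * (β ^ n) ^ 2) := by gcongr
  have h6 : ((2 * β) ^ n) ^ 2 = 2 ^ n * (2 ^ n * (β ^ n) ^ 2) := by ring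
  linarith

/-! ### The exponential generating function -/

theorem AnalyticAt.rpow_const_of_eq_one {b : ℝ → ℝ} {x : ℝ} (hb : AnalyticAt ℝ b x)
    (hbx : b x = 1) (c : ℝ) : AnalyticAt ℝ (fun t => b t ^ c) x := by
  have h1 : AnalyticAt ℝ (fun u : ℝ => (1 + u) ^ c) (b x - 1) := by
    rw [hbx, sub_self]
    exact ⟨_, Real.one_add_rpow_hasFPowerSeriesAt_zero⟩
  have h := AnalyticAt.comp (f := fun t => b t - 1) h1 (hb.sub analyticAt_const)
  refine h.congr (Eventually.of_forall fun t => ?_)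
  simp

theorem hasDerivAt_geometric_column {β ν x : ℝ} {F G : ℝ → ℝ} {t : ℝ}
    (hF : HasDerivAt F (F t * (β * (1 + x) + 2 * ν * β * (1 + x ^ 2) * G t)) t)
    (hG : HasDerivAt G (1 + 2 * ν * (1 + x) * G t + 2 * ν ^ 2 * (1 + x ^ 2) * G t ^ 2) t)
    (k : ℕ) :
    HasDerivAt (fun u => F u * (G u ^ k / (k.factorial : ℝ)))
      (tridiagArray (fun i => (symmetricDiag β ν i).eval x)
        (fun i => (symmetricOffDiag β ν i).eval x)
        (fun i => F t * (G t ^ i / (i.factorial : ℝ))) 1 k) t := by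
  cases k with
  | zero =>
    have h := hF.mul ((hG.pow 0).div_const ((Nat.factorial 0 : ℕ) : ℝ))
    refine h.congr_deriv ?_
    simp [tridiagArray, symmetricDiag, symmetricOffDiag]
    ring
  | succ k =>
    have h := hF.mul ((hG.pow (k + 1)).div_const ((Nat.factorial (k + 1) : ℕ) : ℝ))
    refine h.congr_deriv ?_
    have hk : ((Nat.factorial k : ℕ) : ℝ) ≠ 0 := by positivity
    have hk1 : (k : ℝ) + 1 ≠ 0 := by positivity
    have hk2 : (k : ℝ) + 1 + 1 ≠ 0 := by positivity
    simp only [tridiagArray, symmetricDiag, symmetricOffDiag, eval_mul, eval_C, eval_add,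
      eval_one, eval_X, eval_pow, Nat.factorial_succ, Nat.cast_mul, Nat.cast_add, Nat.cast_one,
      Nat.add_sub_cancel, Nat.cast_ofNat, Pi.pow_apply]
    have hk2' : (k : ℝ) + 2 ≠ 0 := by positivity
    field_simp
    ring

/-- The exponential generating function of the zeroth column, from a solution of the
characteristic system. -/
theorem hasSum_symmetricArray_of_hasDerivAt {β ν x : ℝ} {F G : ℝ → ℝ} (hFa : AnalyticAt ℝ F 0)
    (hF0 : F 0 = 1) (hG0 : G 0 = 0)
    (hF : ∀ᶠ t in nhds (0 : ℝ),
      HasDerivAt F (F t * (β * (1 + x) + 2 * ν * β * (1 + x ^ 2) * G t)) t)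
    (hG : ∀ᶠ t in nhds (0 : ℝ),
      HasDerivAt G (1 + 2 * ν * (1 + x) * G t + 2 * ν ^ 2 * (1 + x ^ 2) * G t ^ 2) t) :
    ∀ᶠ t in nhds (0 : ℝ), HasSum
      (fun n : ℕ => (symmetricArray β ν n 0).eval x * (t ^ n / (n.factorial : ℝ))) (F t) := by
  have hφ : ∀ᶠ t in nhds (0 : ℝ), ∀ k,
      HasDerivAt (fun u => F u * (G u ^ k / (k.factorial : ℝ)))
      (tridiagArray (fun i => (symmetricDiag β ν i).eval x)
        (fun i => (symmetricOffDiag β ν i).eval x)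
        (fun i => F t * (G t ^ i / (i.factorial : ℝ))) 1 k) t := by
    filter_upwards [hF, hG] with t h1 h2 k
    exact hasDerivAt_geometric_column h1 h2 k
  have hcoeff : ∀ n, iteratedDeriv n F 0 = (symmetricArray β ν n 0).eval x := by
    intro n
    have h := (iteratedDeriv_eventuallyEq_tridiagArray
      (φ := fun k u => F u * (G u ^ k / (k.factorial : ℝ))) hφ n 0).self_of_nhds
    simp only [pow_zero, Nat.factorial_zero, Nat.cast_one, div_one, mul_one] at h
    rw [h, ← coe_evalRingHom, symmetricArray, stieltjesArray, map_tridiagArray]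
    congr 1
    funext i
    cases i <;> simp [hF0, hG0]
  filter_upwards [hFa.hasFPowerSeriesAt.eventually_hasSum] with t ht
  rw [zero_add] at ht
  refine ht.congr_fun fun n => ?_
  simp only [FormalMultilinearSeries.ofScalars_apply_eq, hcoeff, smul_eq_mul]
  ring

/-- The exponential generating function as a power of a base. -/
theorem exists_hasSum_symmetricArray_rpow {β ν x : ℝ} (hν : ν ≠ 0) {b G : ℝ → ℝ}
    (hba : AnalyticAt ℝ b 0) (hb0 : b 0 = 1) (hG0 : G 0 = 0)
    (hb : ∀ᶠ t in nhds (0 : ℝ),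
      HasDerivAt b (ν * b t * ((1 + x) + 2 * ν * (1 + x ^ 2) * G t)) t)
    (hG : ∀ᶠ t in nhds (0 : ℝ),
      HasDerivAt G (1 + 2 * ν * (1 + x) * G t + 2 * ν ^ 2 * (1 + x ^ 2) * G t ^ 2) t) :
    ∃ ε : ℝ, 0 < ε ∧ ∀ t : ℝ, |t| < ε → 0 < b t ∧ HasSum
      (fun n : ℕ => (symmetricArray β ν n 0).eval x * (t ^ n / (n.factorial : ℝ)))
      (b t ^ (β / ν)) := by
  have hpos : ∀ᶠ t in nhds (0 : ℝ), 0 < b t :=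
    hba.continuousAt.eventually (lt_mem_nhds (by rw [hb0]; exact one_pos))
  have hFa : AnalyticAt ℝ (fun t => b t ^ (β / ν)) 0 :=
    hba.rpow_const_of_eq_one hb0 _
  have hF : ∀ᶠ t in nhds (0 : ℝ), HasDerivAt (fun u => b u ^ (β / ν))
      (b t ^ (β / ν) * (β * (1 + x) + 2 * ν * β * (1 + x ^ 2) * G t)) t := by
    filter_upwards [hb, hpos] with t ht htp
    refine (ht.rpow_const (Or.inl htp.ne')).congr_deriv ?_
    rw [Real.rpow_sub_one htp.ne']
    field_simp
  have h := hasSum_symmetricArray_of_hasDerivAt hFa (by simp [hb0]) hG0 hF hG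
  obtain ⟨ε, hε, hball⟩ := Metric.eventually_nhds_iff.1 (hpos.and h)
  exact ⟨ε, hε, fun t ht => hball (by simpa using ht)⟩

theorem exists_hasSum_symmetricArray_of_ne_one {β ν x : ℝ} (hν : ν ≠ 0) (hx : x ≠ 1) :
    ∃ ε : ℝ, 0 < ε ∧ ∀ t : ℝ, |t| < ε →
      0 < (1 - x) /
        ((1 - x) * Real.cos (ν * (1 - x) * t) - (1 + x) * Real.sin (ν * (1 - x) * t)) ∧
      HasSum (fun n : ℕ => (symmetricArray β ν n 0).eval x * (t ^ n / (n.factorial : ℝ)))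
        (((1 - x) /
          ((1 - x) * Real.cos (ν * (1 - x) * t) - (1 + x) * Real.sin (ν * (1 - x) * t)))
            ^ (β / ν)) := by
  have hx' : 1 - x ≠ 0 := sub_ne_zero.2 hx.symm
  set D : ℝ → ℝ := fun t =>
    (1 - x) * Real.cos (ν * (1 - x) * t) - (1 + x) * Real.sin (ν * (1 - x) * t) with hD
  have hlin : ∀ t, HasDerivAt (fun u => ν * (1 - x) * u) (ν * (1 - x)) t := fun t => by
    simpa using (hasDerivAt_id t).const_mul (ν * (1 - x))
  have hDd : ∀ t, HasDerivAt D ((1 - x) * (-Real.sin (ν * (1 - x) * t) * (ν * (1 - x)))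
      - (1 + x) * (Real.cos (ν * (1 - x) * t) * (ν * (1 - x)))) t := fun t =>
    ((hlin t).cos.const_mul _).sub ((hlin t).sin.const_mul _)
  have hD0 : D 0 = 1 - x := by simp [hD]
  have hlina : AnalyticAt ℝ (fun u => ν * (1 - x) * u) 0 := analyticAt_const.mul analyticAt_id
  have hDa : AnalyticAt ℝ D 0 :=
    (analyticAt_const.mul (Real.analyticAt_cos.comp hlina)).sub
      (analyticAt_const.mul (Real.analyticAt_sin.comp hlina))
  have hne : ∀ᶠ t in nhds (0 : ℝ), D t ≠ 0 :=
    hDa.continuousAt.eventually_ne (by rwa [hD0])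
  -- The Riccati quadratic has discriminant `-4ν²(1-x)²`, hence the frequency `ν(1-x)`; `D` is the
  -- denominator that linearizes the equation.
  refine exists_hasSum_symmetricArray_rpow hν (b := fun t => (1 - x) / D t)
    (G := fun t => Real.sin (ν * (1 - x) * t) / (ν * D t))
    (analyticAt_const.div hDa (by rwa [hD0])) (by simp [hD0, hx']) (by simp) ?_ ?_
  · filter_upwards [hne] with t ht
    refine ((hasDerivAt_const t (1 - x)).div (hDd t) ht).congr_deriv ?_
    field_simp
    simp only [hD]
    ring_nf
  · filter_upwards [hne] with t ht
    refine ((hlin t).sin.div ((hDd t).const_mul ν) (mul_ne_zero hν ht)).congr_deriv ?_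
    field_simp
    simp only [hD]
    ring

theorem exists_hasSum_symmetricArray_one {β ν : ℝ} (hν : ν ≠ 0) :
    ∃ ε : ℝ, 0 < ε ∧ ∀ t : ℝ, |t| < ε →
      0 < 1 - 2 * ν * t ∧
      HasSum (fun n : ℕ => (symmetricArray β ν n 0).eval 1 * (t ^ n / (n.factorial : ℝ)))
        ((1 / (1 - 2 * ν * t)) ^ (β / ν)) := by
  set D : ℝ → ℝ := fun t => 1 - 2 * ν * t with hD
  have hDd : ∀ t, HasDerivAt D (-(2 * ν)) t := fun t => by
    simpa using ((hasDerivAt_id t).const_mul (2 * ν)).const_sub 1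
  have hD0 : D 0 = 1 := by simp [hD]
  have hDa : AnalyticAt ℝ D 0 := analyticAt_const.sub (analyticAt_const.mul analyticAt_id)
  have hne : ∀ᶠ t in nhds (0 : ℝ), D t ≠ 0 :=
    hDa.continuousAt.eventually_ne (by simp [hD0])
  -- At `x = 1` the quadratic is the square `(1+2νG)²`, so the solution is rational.
  obtain ⟨ε, hε, h⟩ := exists_hasSum_symmetricArray_rpow (β := β) (x := 1) hν
    (b := fun t => 1 / D t) (G := fun t => t / D t)
    (analyticAt_const.div hDa (by simp [hD0])) (by simp [hD0]) (by simp)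
    (by
      filter_upwards [hne] with t ht
      refine ((hasDerivAt_const t (1 : ℝ)).div (hDd t) ht).congr_deriv ?_
      field_simp
      simp only [hD]
      ring)
    (by
      filter_upwards [hne] with t ht
      refine ((hasDerivAt_id t).div (hDd t) ht).congr_deriv ?_
      simp only [id]
      field_simp
      simp only [hD]
      ring)
  exact ⟨ε, hε, fun t ht => ⟨one_div_pos.1 (h t ht).1, (h t ht).2⟩⟩

theorem mainTheorem7 (β μ ν : ℝ) (δ : ℕ) (hδ : 1 ≤ δ) (hμν : μ + ν = 0)
    (T : ℕ → ℝ[X]) (hT : IsSymmetricFamily β μ ν δ T) :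
    -- (i) the exponential generating function, for `x ≠ 1` and (as the limit) for `x = 1`
    (ν ≠ 0 →
      (∀ x : ℝ, x ≠ 1 → ∃ ε : ℝ, 0 < ε ∧ ∀ t : ℝ, |t| < ε →
        0 < (1 - x) /
          ((1 - x) * Real.cos (ν * (1 - x) * t) - (1 + x) * Real.sin (ν * (1 - x) * t)) ∧
        HasSum (fun n : ℕ => (T (n + δ - 1)).eval x * (t ^ n / (n.factorial : ℝ)))
          (((1 - x) /
            ((1 - x) * Real.cos (ν * (1 - x) * t) - (1 + x) * Real.sin (ν * (1 - x) * t)))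
              ^ (β / ν))) ∧
      (∃ ε : ℝ, 0 < ε ∧ ∀ t : ℝ, |t| < ε →
        0 < 1 - 2 * ν * t ∧
        HasSum (fun n : ℕ => (T (n + δ - 1)).eval 1 * (t ^ n / (n.factorial : ℝ)))
          ((1 / (1 - 2 * ν * t)) ^ (β / ν)))) ∧
    -- (ii) the Jacobi continued fraction of the ordinary generating function
    HasJFraction (PowerSeries.mk fun n : ℕ => T (n + δ - 1))
      (fun i : ℕ => C (2 * ν * i + β) * (1 + X))
      (fun i : ℕ => C (2 * ν * i * (β + ν * ((i : ℝ) - 1))) * (1 + X ^ 2)) ∧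
    -- (iii) strong q-log-convexity
    (0 ≤ ν → 0 ≤ β → StronglyQLogConvex fun n : ℕ => T (n + δ - 1)) ∧
    -- (iv) failure of gamma-positivity
    (0 < ν → 0 < β → ∀ n : ℕ, δ + 2 ≤ n → ¬ GammaPositive (T n)) := by
  have hT' : ∀ n, T (n + δ - 1) = symmetricArray β ν n 0 := hT.eq_symmetricArray hδ hμν
  simp only [hT']
  refine ⟨fun hν => ⟨fun x hx => exists_hasSum_symmetricArray_of_ne_one hν hx,
    exists_hasSum_symmetricArray_one hν⟩, hasJFraction_stieltjesArray _ _,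
    stronglyQLogConvex_symmetricArray, fun hν hβ n hn => ?_⟩
  obtain ⟨m, rfl⟩ : ∃ m, n = m + δ - 1 := ⟨n + 1 - δ, by omega⟩
  rw [hT']
  exact not_gammaPositive_symmetricArray hν hβ (by omega)
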